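/- Let $p$ be a prime. Let $G$ be a nilpotent-by-finite compact $p$-adic analytic group whose finite radical $\Delta^+(G)=\{x\in G : x \text{ has finite order and finitely many conjugates in } G\}$ is trivial, and let $H=\mathbf{FN}_p(G)$ be its finite-by-(nilpotent $p$-valuable) radical, i.e. the largest open normal subgroup of $G$ that is finite-by-(nilpotent $p$-valuable). Here a $p$-valuation on a group $\Gamma$ is a function $\omega:\Gamma\to\mathbb{R}\cup\{\infty\}$ such that for all $x,y\in\Gamma$: $\omega(xy^{-1})\ge\min\{\omega(x),\omega(y)\}$; $\omega([x,y])\ge\omega(x)+\omega(y)$; $\omega(x)=\infty$ if and only if $x=1$; $\omega(x)>\frac1{p-1}$; and $\omega(x^p)=\omega(x)+1$. The pair $(\Gamma,\omega)$ is said to have finite rank if the graded group $\mathrm{gr}_\omega\Gamma=\bigoplus_{\lambda\in\mathbb{R}}\{\omega\ge\lambda\}/\{\omega>\lambda\}$ is finitely generated as a module over $\mathbb{F}_p[\pi]$, where $\pi$ acts by $x\mapsto x^p$. A topological group $\Gamma$ is $p$-valuable if it has a $p$-valuation $\omega$ that defines its topology and for which it is complete and of finite rank. Let $L$ be a proper closed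 characteristic subgroup of $H$ which contains the commutator subgroup $[H,H]$ and is isolated, i.e. $H/L$ is torsion-free. Then there is a $p$-valuation $\omega$ on $H$, defining the topology of $H$ and for which $H$ is complete and of finite rank, such that: (i) $\omega$ is $G$-invariant: $\omega(gxg^{-1})=\omega(x)$ for all $g\in G$, $x\in H$; (ii) there is a real number $t>\frac1{p-1}$ such that $\omega(\ell)>t$ for all $\ell\in L$, and the induced function $\Omega(xL)=\sup_{\ell\in L}\omega(x\ell)$ on $A=H/L$ is a $p$-valuation, equal to the $(t,p)$-filtration on $A$; that is, $\Omega(1)=\infty$, and for every $a\in A\setminus\{1\}$ there is an integer $n\ge0$ with $a\in A^{p^n}\setminus A^{p^{n+1}}$ and $\Omega(a)=t+n$. -/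

import Mathlib

open Topology
open scoped Manifold ContDiff commutatorElement

namespace PVal

/-- A `p`-valuation on a group. The value set `ℝ ∪ {∞}` is modelled by `EReal`; the value `⊥`
is excluded by the axiom `lt`. -/
structure IsPValuation (p : ℕ) {Γ : Type*} [Group Γ] (v : Γ → EReal) : Prop where
  min_le : ∀ x y : Γ, min (v x) (v y) ≤ v (x * y⁻¹)
  add_le_commutator : ∀ x y : Γ, v x + v y ≤ v ⁅x, y⁆
  eq_top_iff : ∀ x : Γ, v x = ⊤ ↔ x = 1
  lt : ∀ x : Γ, ((1 / ((p : ℝ) - 1) : ℝ) : EReal) < v x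
  map_pow : ∀ x : Γ, v (x ^ p) = v x + 1

/-- Completeness of a group with respect to `v`: every `v`-Cauchy sequence has a `v`-limit. -/
def IsCompleteFor {Γ : Type*} [Group Γ] (v : Γ → EReal) : Prop :=
  ∀ u : ℕ → Γ,
    (∀ c : ℝ, ∃ N : ℕ, ∀ m ≥ N, ∀ n ≥ N, (c : EReal) ≤ v ((u m)⁻¹ * u n)) →
    ∃ x : Γ, ∀ c : ℝ, ∃ N : ℕ, ∀ n ≥ N, (c : EReal) ≤ v (x⁻¹ * u n)

/-- `(Γ, v)` has finite rank: the graded group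
`gr Γ = ⨁_c {v ≥ c} / {v > c}`, a module over `𝔽_p[π]` on which `π` acts by `x ↦ x ^ p`, is
generated by the principal symbols of finitely many elements `g 0, …, g (e - 1)`. In terms of
elements: every `x ≠ 1` agrees, modulo `{y | v y > v x}`, with a product of powers `g i ^ m i`
of value at least `v x` (the factors of value bigger than `v x` have no effect on the symbol). -/
def HasFiniteRank {Γ : Type*} [Group Γ] (v : Γ → EReal) : Prop :=
  ∃ (e : ℕ) (g : Fin e → Γ), ∀ x : Γ, x ≠ 1 →
    ∃ m : Fin e → ℕ, (∀ i, v x ≤ v (g i ^ m i)) ∧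
      v x < v ((List.ofFn fun i => g i ^ m i).prod⁻¹ * x)

/-- The topological group `Γ`, with the `p`-valuation `v`, is a complete `p`-valued group of finite
rank; its topology is the one given by `v`. -/
structure IsCompletePValued (p : ℕ) {Γ : Type*} [Group Γ] [TopologicalSpace Γ]
    (v : Γ → EReal) : Prop where
  isPValuation : IsPValuation p v
  nhds_one : (𝓝 (1 : Γ)).HasBasis (fun _ : ℝ => True) (fun c => {x : Γ | (c : EReal) ≤ v x})
  complete : IsCompleteFor v
  finiteRank : HasFiniteRank v

/-- A `p`-valuable topological group. -/
def IsPValuable (p : ℕ) (Γ : Type*) [Group Γ] [TopologicalSpace Γ] : Prop :=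
  ∃ v : Γ → EReal, IsCompletePValued p v

/-- A finite-by-(nilpotent `p`-valuable) topological group. -/
def IsFiniteByNilpotentPValuable (p : ℕ) (Γ : Type*) [Group Γ] [TopologicalSpace Γ] : Prop :=
  ∃ (K : Subgroup Γ) (_ : K.Normal),
    Finite K ∧ Group.IsNilpotent (Γ ⧸ K) ∧ IsPValuable p (Γ ⧸ K)

/-- `H = FN_p(G)`, the finite-by-(nilpotent `p`-valuable) radical of `G`: the largest open normal
subgroup of `G` that is finite-by-(nilpotent `p`-valuable). -/
def IsFNp (p : ℕ) {G : Type*} [Group G] [TopologicalSpace G] (H : Subgroup G) : Prop :=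
  IsGreatest {N : Subgroup G | N.Normal ∧ IsOpen (N : Set G) ∧
    IsFiniteByNilpotentPValuable p N} H

/-- `G` is `p`-adic analytic: it carries the structure of a (finite-dimensional) analytic
Lie group over `ℚ_p`. -/
def IsPAdicAnalytic (p : ℕ) [Fact p.Prime] (G : Type*) [Group G] [TopologicalSpace G] : Prop :=
  ∃ (d : ℕ) (_ : ChartedSpace (Fin d → ℚ_[p]) G),
    LieGroup 𝓘(ℚ_[p], Fin d → ℚ_[p]) ω G

/-- The finite radical `Δ⁺(G)`: the elements of finite order with finitely many conjugates. -/
def finiteRadical (G : Type*) [Group G] : Set G :=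
  {x | IsOfFinOrder x ∧ (conjugatesOf x).Finite}

/-- A normal subgroup `L` is isolated if the quotient by it is torsion-free. -/
def IsIsolated {Γ : Type*} [Group Γ] (L : Subgroup Γ) : Prop :=
  ∀ (x : Γ) (n : ℕ), n ≠ 0 → x ^ n ∈ L → x ∈ L

/-- A subgroup of a topological group is characteristic if all continuous automorphisms (with
continuous inverse) preserve it. -/
def IsCharacteristic {Γ : Type*} [Group Γ] [TopologicalSpace Γ] (L : Subgroup Γ) : Prop :=
  ∀ φ : Γ ≃ₜ* Γ, ∀ x ∈ L, φ x ∈ L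

/-- The function `gK ↦ sup_{k ∈ K} v (g k)` induced by `v` on the quotient by `K`. -/
noncomputable def quotientVal {Γ : Type*} [Group Γ] (K : Subgroup Γ) (v : Γ → EReal) :
    Γ ⧸ K → EReal :=
  fun q => ⨆ g : {g : Γ // (g : Γ ⧸ K) = q}, v g

theorem quotientVal_mk {Γ : Type*} [Group Γ] (K : Subgroup Γ) (v : Γ → EReal) (g : Γ) :
    quotientVal K v (g : Γ ⧸ K) = ⨆ k : K, v (g * k) := by
  unfold quotientVal
  apply le_antisymm
  · refine iSup_le fun h => ?_
    have hk : g⁻¹ * (h : Γ) ∈ K := QuotientGroup.eq.1 h.2.symm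
    refine le_trans (le_of_eq ?_) (le_iSup (fun k : K => v (g * k)) ⟨_, hk⟩)
    simp
  · refine iSup_le fun k => ?_
    exact le_iSup (fun h : {h : Γ // (h : Γ ⧸ K) = (g : Γ ⧸ K)} => v h) ⟨g * k, by simp⟩

/-- `f` is the `(t, p)`-filtration on the (abelian) group `A`: `f 1 = ∞`, and
`f x = t + n` if `x ≠ 1` lies in `A ^ (p ^ n)` but not in `A ^ (p ^ (n + 1))`. -/
def IsTPFiltration (p : ℕ) (t : ℝ) {A : Type*} [Group A] (f : A → EReal) : Prop :=
  f 1 = ⊤ ∧ ∀ x : A, x ≠ 1 → ∃ n : ℕ,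
    (∃ y : A, y ^ p ^ n = x) ∧ (¬ ∃ y : A, y ^ p ^ (n + 1) = x) ∧
      f x = ((t + n : ℝ) : EReal)

end PVal

/-!
Let `v₀` be a `p`-valuation of `H`. One exists, because the finite normal subgroup `K` by which `H`
is finite-by-(nilpotent `p`-valuable) consists of elements of finite order with finitely many
conjugates in `G`, so that it is trivial (`IsFNp.isPValuable`).

A `p`-valuation is invariant under inner automorphisms, so `G` moves `v₀` through finitely many
functions, one for each coset of `H`; their minimum `w` is a `G`-invariant `p`-valuation that still
defines the topology (`exists_invariant_isPValuation`). By compactness of `H` there is a real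
`t > 1 / (p - 1)` with `w x > t` for all `x` (`exists_lt_forall_lt`). Let `f` be the
`(t, p)`-filtration on the torsion-free abelian group `A = H / L`; it exists because `L` is closed
(`exists_not_pow_of_ne_one`), it is a `p`-valuation, and every automorphism of `A` preserves it.
The valuation sought is `v x = min (w x) (f (xL))`. On `L` it agrees with `w`, hence exceeds `t`.
Its quotient valuation is `f`: if `f (xL) = t + n`, then `xL` contains some `y ^ p ^ n`, and
`w (y ^ p ^ n) = w y + n > t + n` (`quotientVal_min`).

What remains is that `v` defines the topology of `H` and has finite rank. Both follow from the fact
that the image of `x ↦ x ^ n` is a neighbourhood of `1` for `n ≠ 0`: on a `p`-adic Lie group the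
derivative of this map at `1` is multiplication by `n`, and the inverse function theorem applies
(`map_pow_nhds_one`). Thus `{x | f (xL) ≥ t + n}`, which contains all `p ^ n`-th powers, is open.
For finite rank, elements of large value are `p`-th powers, so that each `x ≠ 1` is `y ^ p ^ n`
with `v y` below a fixed bound `c`, and representatives of the finitely many cosets of `{v ≥ c}`
generate the graded group (`hasFiniteRank`). This uses that `x ↦ x ^ p` induces a well-defined map
on the graded group: `v (x⁻¹ y) > v x` implies `v (x⁻ᵖ yᵖ) > v (xᵖ)` (`lt_map_pow_prime`). That
is proved with polynomial sequences `ℕ → Γ`, which form a group (Lazard, Leibman) and have Taylor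
expansions `n ↦ ∏ c_j ^ (n choose j)`.
-/

namespace PVal

/-! ### The power map of a Lie group near the identity -/

/-- On a Lie group over a field in which `n` is invertible, `x ↦ x ^ n` is open at the identity:
its derivative there is multiplication by `n`. -/
theorem map_pow_nhds_one {𝕜 E G : Type*} [NontriviallyNormedField 𝕜]
    [NormedAddCommGroup E] [NormedSpace 𝕜 E] [CompleteSpace E] [Group G] [TopologicalSpace G]
    [ChartedSpace E G] [LieGroup 𝓘(𝕜, E) ω G] {n : ℕ} (hn : (n : 𝕜) ≠ 0) :
    Filter.map (fun x : G => x ^ n) (𝓝 1) = 𝓝 1 := by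
  have : IsTopologicalGroup G := topologicalGroup_of_lieGroup 𝓘(𝕜, E) ω
  set φ := chartAt E (1 : G) with hφ
  have h1 : (1 : G) ∈ φ.source := mem_chart_source E 1
  have he : φ 1 ∈ φ.target := φ.map_source h1
  -- The multiplication read in the chart.
  set M : E × E → E := fun q => φ (φ.symm q.1 * φ.symm q.2) with hM
  have hMd : ContDiffAt 𝕜 ω M (φ 1, φ 1) := by
    rw [← contMDiffAt_iff_contDiffAt]
    have hs : ContMDiffAt 𝓘(𝕜, E) 𝓘(𝕜, E) ω φ.symm (φ 1) :=
      (contMDiffOn_chart_symm (I := 𝓘(𝕜, E)) (x := (1 : G))).contMDiffAt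
        (φ.open_target.mem_nhds he)
    have hc : ContMDiffAt 𝓘(𝕜, E) 𝓘(𝕜, E) ω φ (φ.symm (φ 1) * φ.symm (φ 1)) := by
      rw [φ.left_inv h1, mul_one]
      exact (contMDiffOn_chart (I := 𝓘(𝕜, E)) (x := (1 : G))).contMDiffAt
        (φ.open_source.mem_nhds h1)
    have hf : ContMDiffAt 𝓘(𝕜, E × E) 𝓘(𝕜, E) ω (fun q : E × E => φ.symm q.1) (φ 1, φ 1) :=
      ContMDiffAt.comp (φ 1, φ 1) (by exact hs) contDiff_fst.contMDiff.contMDiffAt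
    have hg : ContMDiffAt 𝓘(𝕜, E × E) 𝓘(𝕜, E) ω (fun q : E × E => φ.symm q.2) (φ 1, φ 1) :=
      ContMDiffAt.comp (φ 1, φ 1) (by exact hs) contDiff_snd.contMDiff.contMDiffAt
    exact ContMDiffAt.comp (φ 1, φ 1) (by exact hc) (hf.mul hg)
  obtain ⟨M', hM'⟩ : ∃ M' : E × E →L[𝕜] E, HasStrictFDerivAt M M' (φ 1, φ 1) :=
    ⟨_, hMd.analyticAt.hasStrictFDerivAt⟩
  have hnear : ∀ᶠ u in 𝓝 (φ 1), u ∈ φ.target := φ.open_target.mem_nhds he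
  -- `M (u, φ 1) = u = M (φ 1, u)`, so the derivative of `M` at `(φ 1, φ 1)` is addition.
  have hl : M'.comp (.inl 𝕜 E E) = .id 𝕜 E := by
    have h : HasFDerivAt (fun u => M (u, φ 1)) (M'.comp (.inl 𝕜 E E)) (φ 1) :=
      HasFDerivAt.comp (f := fun u => (u, φ 1)) (φ 1) hM'.hasFDerivAt
        (hasFDerivAt_prodMk_left (φ 1) (φ 1))
    refine h.unique ((hasFDerivAt_id (φ 1)).congr_of_eventuallyEq ?_)
    filter_upwards [hnear] with u hu
    simp [hM, φ.left_inv h1, φ.right_inv hu]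
  have hr : M'.comp (.inr 𝕜 E E) = .id 𝕜 E := by
    have h : HasFDerivAt (fun u => M (φ 1, u)) (M'.comp (.inr 𝕜 E E)) (φ 1) :=
      hM'.hasFDerivAt.comp (φ 1) (hasFDerivAt_prodMk_right (φ 1) (φ 1))
    refine h.unique ((hasFDerivAt_id (φ 1)).congr_of_eventuallyEq ?_)
    filter_upwards [hnear] with u hu
    simp [hM, φ.left_inv h1, φ.right_inv hu]
  have hcs : ContinuousAt φ.symm (φ 1) := φ.continuousAt_symm he
  have hpow : ∀ m : ℕ, HasStrictFDerivAt (fun u => φ (φ.symm u ^ m))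
      ((m : 𝕜) • ContinuousLinearMap.id 𝕜 E) (φ 1) := by
    intro m
    induction m with
    | zero => simpa using hasStrictFDerivAt_const (𝕜 := 𝕜) (φ 1) (φ 1)
    | succ m ih =>
      have h : HasStrictFDerivAt (fun u => M (φ (φ.symm u ^ m), u))
          (M'.comp (((m : 𝕜) • ContinuousLinearMap.id 𝕜 E).prod (.id 𝕜 E))) (φ 1) := by
        refine HasStrictFDerivAt.comp (φ 1) ?_ (ih.prodMk (hasStrictFDerivAt_id (φ 1)))
        simpa [φ.left_inv h1] using hM'
      have hM'' : M'.comp (((m : 𝕜) • ContinuousLinearMap.id 𝕜 E).prod (.id 𝕜 E)) =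
          ((m + 1 : ℕ) : 𝕜) • ContinuousLinearMap.id 𝕜 E := by
        ext u
        have e1 : M' (u, 0) = u := by simpa using DFunLike.congr_fun hl u
        have e2 : M' (0, u) = u := by simpa using DFunLike.congr_fun hr u
        have e3 : ((m : 𝕜) • u, u) = (m : 𝕜) • ((u, 0) : E × E) + (0, u) := by simp
        simp only [ContinuousLinearMap.comp_apply, ContinuousLinearMap.prod_apply,
          smul_apply, ContinuousLinearMap.id_apply]
        rw [e3, map_add, map_smul, e1, e2]
        push_cast
        rw [add_smul, one_smul]
      rw [hM''] at h
      refine h.congr_of_eventuallyEq ?_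
      have hsrc : ∀ᶠ u in 𝓝 (φ 1), φ.symm u ^ m ∈ φ.source := by
        refine (hcs.pow m).eventually (φ.open_source.mem_nhds ?_)
        simpa [φ.left_inv h1] using h1
      filter_upwards [hsrc] with u hu
      simp [hM, φ.left_inv hu, pow_succ]
  let e : E ≃L[𝕜] E := .equivOfInverse ((n : 𝕜) • .id 𝕜 E) ((n : 𝕜)⁻¹ • .id 𝕜 E)
    (fun u => by simp [smul_smul, hn]) (fun u => by simp [smul_smul, hn])
  have hmap : Filter.map (fun u => φ (φ.symm u ^ n)) (𝓝 (φ 1)) = 𝓝 (φ 1) := by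
    simpa [φ.left_inv h1] using HasStrictFDerivAt.map_nhds_eq_of_equiv (f' := e) (hpow n)
  have h2 : Filter.map (fun x : G => x ^ n) (𝓝 1) =
      Filter.map (φ.symm ∘ (fun u => φ (φ.symm u ^ n)) ∘ φ) (𝓝 1) := by
    refine Filter.map_congr ?_
    have hsrc : ∀ᶠ x : G in 𝓝 1, x ^ n ∈ φ.source :=
      (continuous_pow n).continuousAt.eventually (φ.open_source.mem_nhds (by simpa using h1))
    filter_upwards [hsrc, φ.open_source.mem_nhds h1] with x hx hx1
    simp [φ.left_inv hx1, φ.left_inv hx]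
  rw [h2, ← Filter.map_map, ← Filter.map_map, φ.map_nhds_eq h1, hmap,
    φ.symm.map_nhds_eq he, φ.left_inv h1]

/-! ### Polynomial sequences in a filtered group -/

/-- Sequences `f` in a group filtered by subgroups `N 0, N 1, …` that are polynomial of weight `i`,
tested up to depth `K`: for `k ≤ K` the `k`-th iterate of the derivative
`f ↦ fun n => (f n)⁻¹ * f (n + 1)` sends `f` to a sequence with values in `N (i + k)`. -/
def polySeq {Γ : Type*} [Group Γ] (N : ℕ → Subgroup Γ) : ℕ → ℕ → Set (ℕ → Γ)
  | 0, i => {f | ∀ n, f n ∈ N i}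
  | K + 1, i => {f | (∀ n, f n ∈ N i) ∧ (fun n => (f n)⁻¹ * f (n + 1)) ∈ polySeq N K (i + 1)}

section
variable {Γ : Type*} [Group Γ] {N : ℕ → Subgroup Γ}

theorem polySeq_apply_mem {K i : ℕ} {f : ℕ → Γ} (hf : f ∈ polySeq N K i) (n : ℕ) :
    f n ∈ N i := by
  cases K with
  | zero => exact hf n
  | succ K => exact hf.1 n

theorem polySeq_succ_subset (K i : ℕ) : polySeq N (K + 1) i ⊆ polySeq N K i := by
  induction K generalizing i with
  | zero => exact fun f hf => hf.1
  | succ K ih => exact fun f hf => ⟨hf.1, ih _ hf.2⟩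

theorem polySeq_antitone (hN : Antitone N) (K : ℕ) : Antitone (polySeq N K) := by
  induction K with
  | zero => exact fun i j hij f hf n => hN hij (hf n)
  | succ K ih =>
    exact fun i j hij f hf => ⟨fun n => hN hij (hf.1 n), ih (Nat.add_le_add_right hij 1) hf.2⟩

/-- If the filtration satisfies `⁅N i, N j⁆ ≤ N (i + j)`, then polynomial sequences are closed
under products and inverses, and weights add under commutators. -/
theorem polySeq_closed (hN : Antitone N)
    (hcomm : ∀ i j x y, x ∈ N i → y ∈ N j → ⁅x, y⁆ ∈ N (i + j)) (K : ℕ) :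
    (∀ i f g, f ∈ polySeq N K i → g ∈ polySeq N K i → f * g ∈ polySeq N K i) ∧
    (∀ i f, f ∈ polySeq N K i → f⁻¹ ∈ polySeq N K i) ∧
    (∀ i j f g, f ∈ polySeq N K i → g ∈ polySeq N K j → ⁅f, g⁆ ∈ polySeq N K (i + j)) := by
  induction K with
  | zero =>
    exact ⟨fun i f g hf hg n => mul_mem (hf n) (hg n), fun i f hf n => inv_mem (hf n),
      fun i j f g hf hg n => hcomm i j _ _ (hf n) (hg n)⟩
  | succ K ih =>
    obtain ⟨hmul, hinv, hcom⟩ := ih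
    have hanti := polySeq_antitone hN K
    have hconj : ∀ l m h q, h ∈ polySeq N K l → q ∈ polySeq N K m →
        h * q * h⁻¹ ∈ polySeq N K m := by
      intro l m h q hh hq
      have e : h * q * h⁻¹ = ⁅h, q⁆ * q := by simp [commutatorElement_def]
      rw [e]
      exact hmul _ _ _ (hanti (Nat.le_add_left m l) (hcom _ _ _ _ hh hq)) hq
    refine ⟨fun i f g hf hg => ⟨fun n => mul_mem (hf.1 n) (hg.1 n), ?_⟩,
      fun i f hf => ⟨fun n => inv_mem (hf.1 n), ?_⟩,
      fun i j f g hf hg => ⟨fun n => hcomm i j _ _ (hf.1 n) (hg.1 n), ?_⟩⟩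
    -- The derivative of `f * g` is `(g⁻¹ * ∂f * g) * ∂g`.
    · have hgK := polySeq_succ_subset K i hg
      convert hmul _ _ _ (hconj _ _ _ _ (hinv _ _ hgK) hf.2) hg.2 using 1
      funext n
      simp only [Pi.mul_apply, Pi.inv_apply]
      group
    -- The derivative of `f⁻¹` is `f * (∂f)⁻¹ * f⁻¹`.
    · have hfK := polySeq_succ_subset K i hf
      convert hconj _ _ _ _ hfK (hinv _ _ hf.2) using 1
      funext n
      simp only [Pi.mul_apply, Pi.inv_apply]
      group
    -- The derivative `⁅f, g⁆⁻¹ * ⁅f * ∂f, g * ∂g⁆` of `⁅f, g⁆` is a product of conjugates of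
    -- `⁅∂f, g * ∂g⁆` and `⁅f, ∂g⁆`, both of weight `i + j + 1`.
    · have hfK := polySeq_succ_subset K i hf
      have hgK := polySeq_succ_subset K j hg
      obtain ⟨-, hD⟩ := hf
      obtain ⟨-, hE⟩ := hg
      set D : ℕ → Γ := fun n => (f n)⁻¹ * f (n + 1) with hDdef
      set E : ℕ → Γ := fun n => (g n)⁻¹ * g (n + 1) with hEdef
      have hgE : g * E ∈ polySeq N K j := hmul _ _ _ hgK (hanti (Nat.le_succ j) hE)
      have h1 : ⁅D, g * E⁆ ∈ polySeq N K (i + j + 1) := by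
        have := hcom _ _ _ _ hD hgE
        rwa [show i + 1 + j = i + j + 1 by omega] at this
      have h2 : ⁅f, E⁆ ∈ polySeq N K (i + j + 1) := hcom i (j + 1) _ _ hfK hE
      have h0 : ⁅f, g⁆⁻¹ * f ∈ polySeq N K 0 :=
        hmul _ _ _ (hanti (Nat.zero_le _) (hinv _ _ (hcom _ _ _ _ hfK hgK)))
          (hanti (Nat.zero_le _) hfK)
      convert hmul _ _ _ (hconj _ _ _ _ h0 h1) (hconj _ _ _ _ hgK h2) using 1
      funext n
      simp only [Pi.mul_apply, Pi.inv_apply, commutatorElement_def, hDdef, hEdef]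
      group

theorem pow_choose_mem_polySeq (hN : Antitone N) (K i j : ℕ) {c : Γ} (hc : c ∈ N (i + j)) :
    (fun n : ℕ => c ^ n.choose j) ∈ polySeq N K i := by
  induction K generalizing i j c with
  | zero => exact fun n => pow_mem (hN (Nat.le_add_right i j) hc) _
  | succ K ih =>
    refine ⟨fun n => pow_mem (hN (Nat.le_add_right i j) hc) _, ?_⟩
    cases j with
    | zero => simpa using ih (i + 1) 0 (c := 1) (one_mem _)
    | succ j =>
      have e : (fun n : ℕ => (c ^ n.choose (j + 1))⁻¹ * c ^ (n + 1).choose (j + 1)) =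
          fun n => c ^ n.choose j := by
        funext n
        rw [Nat.choose_succ_succ', Nat.add_comm (n.choose j), pow_add, inv_mul_cancel_left]
      rw [e]
      exact ih (i + 1) j (by rwa [show i + 1 + j = i + (j + 1) by omega])

/-- The first Taylor coefficient of a polynomial sequence that can differ from `1` lies in the
filtration step given by its position. -/
theorem polySeq_apply_of_eq_one {K i j : ℕ} (hj : j ≤ K) {f : ℕ → Γ} (hf : f ∈ polySeq N K i)
    (h1 : ∀ m < j, f m = 1) : f j ∈ N (i + j) := by
  induction j generalizing K i f with
  | zero => exact polySeq_apply_mem hf 0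
  | succ j ih =>
    obtain ⟨K, rfl⟩ : ∃ K', K = K' + 1 := ⟨K - 1, by omega⟩
    have := ih (Nat.le_of_succ_le_succ hj) hf.2 fun m hm => by
      rw [h1 m (by omega), h1 (m + 1) (by omega)]; simp
    rw [h1 j (by omega), inv_one, one_mul] at this
    rwa [show i + (j + 1) = i + 1 + j by omega]
end

/-! ### The `p`-th power map and `p`-valuations -/

namespace IsPValuation
variable {p : ℕ} {Γ : Type*} [Group Γ] {v : Γ → EReal}

theorem map_one (hv : IsPValuation p v) : v 1 = ⊤ := (hv.eq_top_iff 1).2 rfl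

theorem le_map_inv (hv : IsPValuation p v) (x : Γ) : v x ≤ v x⁻¹ := by
  simpa [hv.map_one] using hv.min_le 1 x

theorem map_inv (hv : IsPValuation p v) (x : Γ) : v x⁻¹ = v x :=
  le_antisymm (by simpa using hv.le_map_inv x⁻¹) (hv.le_map_inv x)

theorem min_le_mul (hv : IsPValuation p v) (x y : Γ) : min (v x) (v y) ≤ v (x * y) := by
  simpa [hv.map_inv] using hv.min_le x y⁻¹

/-- The subgroup of elements of value at least `c`. -/
def ball (hv : IsPValuation p v) (c : EReal) : Subgroup Γ where
  carrier := {x | c ≤ v x}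
  mul_mem' ha hb := (le_min ha hb).trans (hv.min_le_mul _ _)
  one_mem' := by simp [hv.map_one]
  inv_mem' ha := by simpa [hv.map_inv] using ha

theorem mem_ball (hv : IsPValuation p v) {c : EReal} {x : Γ} : x ∈ hv.ball c ↔ c ≤ v x := Iff.rfl

theorem le_map_pow (hv : IsPValuation p v) (x : Γ) (n : ℕ) : v x ≤ v (x ^ n) :=
  (hv.ball (v x)).pow_mem (hv.mem_ball.2 le_rfl) n

theorem pos (hp : 1 < p) (hv : IsPValuation p v) (x : Γ) : 0 < v x := by
  refine lt_trans ?_ (hv.lt x)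
  have : (1 : ℝ) < p := by exact_mod_cast hp
  exact_mod_cast one_div_pos.2 (sub_pos.2 this)

theorem exists_real (hp : 1 < p) (hv : IsPValuation p v) {x : Γ} (hx : x ≠ 1) :
    ∃ a : ℝ, v x = a :=
  ⟨(v x).toReal, (EReal.coe_toReal (fun h => hx ((hv.eq_top_iff x).1 h))
    (ne_bot_of_gt (hv.pos hp x))).symm⟩

theorem map_pow_prime_pow (hv : IsPValuation p v) (x : Γ) (n : ℕ) :
    v (x ^ p ^ n) = v x + n := by
  induction n with
  | zero => simp
  | succ n ih =>
    rw [pow_succ, pow_mul, hv.map_pow, ih, Nat.cast_succ, add_assoc]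

/-- The `p`-th power map is well defined on principal symbols: it preserves congruence modulo
elements of strictly larger value. -/
theorem lt_map_pow_prime (hp : p.Prime) (hv : IsPValuation p v) {x y : Γ}
    (h : v x < v (x⁻¹ * y)) : v (x ^ p) < v ((x ^ p)⁻¹ * y ^ p) := by
  have hx1 : x ≠ 1 := fun hx => by
    rw [hx, hv.map_one] at h; exact not_top_lt h
  obtain ⟨a, ha⟩ := hv.exists_real hp.one_lt hx1
  have hp1 : (1 : ℝ) < p := by exact_mod_cast hp.one_lt
  have ha1 : 1 / ((p : ℝ) - 1) < a := by
    have := hv.lt x; rw [ha] at this; exact_mod_cast this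
  have ha0 : 0 < a := lt_trans (one_div_pos.2 (sub_pos.2 hp1)) ha1
  have hpa : a + 1 < p * a := by
    rw [div_lt_iff₀ (sub_pos.2 hp1)] at ha1; linarith
  rw [ha] at h
  rw [hv.map_pow, ha]
  let N : ℕ → Subgroup Γ := fun j => hv.ball ((j * a : ℝ) : EReal)
  have hN : Antitone N := by
    intro i j hij z hz
    refine le_trans ?_ (hv.mem_ball.1 hz)
    have : (i : ℝ) ≤ j := by exact_mod_cast hij
    exact_mod_cast mul_le_mul_of_nonneg_right this ha0.le
  have hcomm : ∀ i j z w, z ∈ N i → w ∈ N j → ⁅z, w⁆ ∈ N (i + j) := by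
    intro i j z w hz hw
    refine le_trans ?_ ((add_le_add hz hw).trans (hv.add_le_commutator z w))
    rw [← EReal.coe_add, ← add_mul]
    push_cast
    exact le_rfl
  obtain ⟨hmul, hinv, -⟩ := polySeq_closed hN hcomm p
  -- A polynomial sequence is a product of factors `c ^ (n choose j)` with `c ∈ N j`; these are
  -- split off one at a time. At `n = p` the factors with `1 ≤ j < p` are `p`-th powers of elements
  -- of value above `a`, and the one with `j = p` has value at least `p * a > a + 1`.
  have key : ∀ k j : ℕ, j + k = p → 1 ≤ j → ∀ f ∈ polySeq N p 0, (∀ m < j, f m = 1) →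
      (a : EReal) < v (f 1) → (a : EReal) + 1 < v (f p) := by
    intro k
    induction k with
    | zero =>
      intro j hj _ f hf hf1 _
      obtain rfl : j = p := hj
      have : f j ∈ N (0 + j) := polySeq_apply_of_eq_one le_rfl hf hf1
      rw [zero_add] at this
      refine lt_of_lt_of_le ?_ this
      exact_mod_cast hpa
    | succ k ih =>
      intro j hj hj1 f hf hf1 hfa
      have hc : f j ∈ N (0 + j) := polySeq_apply_of_eq_one (by omega) hf hf1
      set c := f j with hcdef
      have hca : (a : EReal) < v c := by
        rcases hj1.eq_or_lt with rfl | hj2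
        · exact hfa
        · rw [zero_add] at hc
          refine lt_of_lt_of_le ?_ hc
          have : (2 : ℝ) ≤ j := by exact_mod_cast hj2
          have : a < j * a := by nlinarith
          exact_mod_cast this
      set g : ℕ → Γ := f * (fun n : ℕ => c ^ n.choose j)⁻¹ with hg
      have hgp : g ∈ polySeq N p 0 :=
        hmul _ _ _ hf (hinv _ _ (pow_choose_mem_polySeq hN p 0 j hc))
      have hg1 : ∀ m < j + 1, g m = 1 := by
        intro m hm
        rcases (Nat.lt_succ_iff.1 hm).eq_or_lt with rfl | hm
        · simp [hg, hcdef]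
        · simp [hg, hf1 m hm, Nat.choose_eq_zero_of_lt hm]
      have hgv := ih (j + 1) (by omega) (by omega) g hgp hg1
        (by rw [hg1 1 (by omega), hv.map_one]; exact EReal.coe_lt_top a)
      have hcv : (a : EReal) + 1 < v (c ^ p.choose j) := by
        obtain ⟨m, hm⟩ := hp.dvd_choose_self (by omega : j ≠ 0) (by omega : j < p)
        rw [hm, pow_mul]
        refine lt_of_lt_of_le ?_ (hv.le_map_pow _ m)
        rw [hv.map_pow]
        exact EReal.add_lt_add_of_lt_of_le hca le_rfl (EReal.coe_ne_bot 1) (EReal.coe_ne_top 1)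
      have e : f p = g p * c ^ p.choose j := by simp [hg]
      rw [e]
      exact (lt_min hgv hcv).trans_le (hv.min_le_mul _ _)
  have hx : x ∈ N 1 := by
    change ((1 : ℕ) * a : ℝ) ≤ v x
    simp [ha]
  have hy : y ∈ N 1 := by
    have : x⁻¹ * y ∈ N 1 := by
      change ((1 : ℕ) * a : ℝ) ≤ v (x⁻¹ * y)
      simpa using h.le
    simpa using mul_mem hx this
  have hpoly : ∀ z ∈ N 1, (fun n => z ^ n) ∈ polySeq N p 0 := fun z hz => by
    simpa using pow_choose_mem_polySeq hN p 0 1 (c := z) (by simpa using hz)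
  have := key (p - 1) 1 (by have := hp.one_lt; omega) le_rfl
    ((fun n => x ^ n)⁻¹ * fun n => y ^ n) (hmul _ _ _ (hinv _ _ (hpoly x hx)) (hpoly y hy))
    (by intro m hm; obtain rfl : m = 0 := by omega
        simp) (by simpa using h)
  simpa using this

theorem lt_map_pow_prime_pow (hp : p.Prime) (hv : IsPValuation p v) {x y : Γ}
    (h : v x < v (x⁻¹ * y)) (n : ℕ) : v (x ^ p ^ n) < v ((x ^ p ^ n)⁻¹ * y ^ p ^ n) := by
  induction n with
  | zero => simpa using h
  | succ n ih => simpa only [pow_succ, pow_mul] using hv.lt_map_pow_prime hp ih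

end IsPValuation

/-! ### The `(t, p)`-filtration on an abelian group -/

namespace IsTPFiltration
variable {p : ℕ} {t : ℝ} {A : Type*} [CommGroup A] {f : A → EReal}

theorem exists_of_le {m n : ℕ} (hmn : m ≤ n) {x : A} (h : ∃ y, y ^ p ^ n = x) :
    ∃ y, y ^ p ^ m = x := by
  obtain ⟨y, rfl⟩ := h
  refine ⟨y ^ p ^ (n - m), ?_⟩
  rw [← pow_mul, ← pow_add, Nat.sub_add_cancel hmn]

theorem le_iff (hf : IsTPFiltration p t f) (x : A) (m : ℕ) :
    ((t + m : ℝ) : EReal) ≤ f x ↔ ∃ y, y ^ p ^ m = x := by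
  by_cases hx : x = 1
  · subst hx
    simpa [hf.1] using ⟨1, one_pow _⟩
  obtain ⟨n, h1, h2, h3⟩ := hf.2 x hx
  rw [h3, EReal.coe_le_coe_iff, add_le_add_iff_left, Nat.cast_le]
  exact ⟨fun h => exists_of_le h h1,
    fun h => le_of_not_gt fun hn => h2 (exists_of_le hn h)⟩

theorem unique {g : A → EReal} (hf : IsTPFiltration p t f) (hg : IsTPFiltration p t g) :
    f = g := by
  funext x
  by_cases hx : x = 1
  · rw [hx, hf.1, hg.1]
  obtain ⟨n, h1, h2, h3⟩ := hf.2 x hx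
  obtain ⟨m, k1, k2, k3⟩ := hg.2 x hx
  apply le_antisymm
  · rw [h3]; exact (hg.le_iff x n).2 h1
  · rw [k3]; exact (hf.le_iff x m).2 k1

theorem comp_mulEquiv (hf : IsTPFiltration p t f) (φ : A ≃* A) (x : A) : f (φ x) = f x := by
  have hφ : ∀ (n : ℕ) (x : A), (∃ y, y ^ n = φ x) ↔ ∃ y, y ^ n = x := by
    intro n x
    constructor
    · rintro ⟨y, hy⟩
      exact ⟨φ.symm y, by rw [← _root_.map_pow, hy, φ.symm_apply_apply]⟩
    · rintro ⟨y, rfl⟩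
      exact ⟨φ y, (_root_.map_pow φ y n).symm⟩
  have h : IsTPFiltration p t (f ∘ φ) := by
    refine ⟨by simp [hf.1], fun x hx => ?_⟩
    obtain ⟨n, h1, h2, h3⟩ := hf.2 (φ x) (by simpa using hx)
    exact ⟨n, (hφ _ x).1 h1, fun h => h2 ((hφ _ x).2 h), h3⟩
  exact congrFun (h.unique hf) x

/-- On an abelian group without `p`-torsion the `(t, p)`-filtration is a `p`-valuation. -/
theorem isPValuation (ht : 1 / ((p : ℝ) - 1) < t)
    (htf : ∀ x : A, x ^ p = 1 → x = 1) (hf : IsTPFiltration p t f) : IsPValuation p f where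
  min_le x y := by
    have key : ∀ (m : ℕ), ((t + m : ℝ) : EReal) ≤ f x → ((t + m : ℝ) : EReal) ≤ f y →
        ((t + m : ℝ) : EReal) ≤ f (x * y⁻¹) := by
      intro m hx hy
      rw [hf.le_iff] at *
      obtain ⟨a, rfl⟩ := hx
      obtain ⟨b, rfl⟩ := hy
      exact ⟨a * b⁻¹, by rw [mul_pow, inv_pow]⟩
    rcases eq_or_ne x 1 with rfl | hx
    · rcases eq_or_ne y 1 with rfl | hy
      · simp
      · obtain ⟨m, -, -, h⟩ := hf.2 y hy
        rw [hf.1, min_eq_right le_top, h]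
        exact key m (by simp [hf.1]) h.ge
    · obtain ⟨n, -, -, hn⟩ := hf.2 x hx
      rcases le_total (f x) (f y) with hxy | hxy
      · rw [min_eq_left hxy, hn]
        exact key n hn.ge (hn ▸ hxy)
      · have hy : y ≠ 1 := by
          rintro rfl
          rw [hf.1, hn] at hxy
          exact EReal.coe_ne_top _ (top_le_iff.1 hxy)
        obtain ⟨m, -, -, hm⟩ := hf.2 y hy
        rw [min_eq_right hxy, hm]
        exact key m (hm ▸ hxy) hm.ge
  add_le_commutator x y := by
    rw [commutatorElement_eq_one_iff_mul_comm.2 (mul_comm x y), hf.1]; exact le_top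
  eq_top_iff x := by
    refine ⟨fun h => by_contra fun hx => ?_, fun h => h ▸ hf.1⟩
    obtain ⟨n, -, -, h3⟩ := hf.2 x hx
    exact EReal.coe_ne_top _ (h3.symm.trans h)
  lt x := by
    have := (hf.le_iff x 0).2 ⟨x, by simp⟩
    refine lt_of_lt_of_le ?_ this
    simpa using ht
  map_pow x := by
    rcases eq_or_ne x 1 with rfl | hx
    · rw [one_pow, hf.1]; rfl
    have hxp : x ^ p ≠ 1 := fun h => hx (htf x h)
    obtain ⟨n, ⟨y, hy⟩, h2, h3⟩ := hf.2 x hx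
    have h : f (x ^ p) = ((t + (n + 1 : ℕ) : ℝ) : EReal) := by
      apply le_antisymm
      · obtain ⟨m, ⟨z, hz⟩, -, hm⟩ := hf.2 (x ^ p) hxp
        rw [hm, EReal.coe_le_coe_iff, add_le_add_iff_left, Nat.cast_le]
        by_contra! hnm
        obtain ⟨w, hw⟩ := exists_of_le (show n + 1 + 1 ≤ m by omega) ⟨z, hz⟩
        refine h2 ⟨w, ?_⟩
        have : (w ^ p ^ (n + 1) * x⁻¹) ^ p = 1 := by
          rw [mul_pow, ← pow_mul, ← pow_succ, hw, inv_pow, mul_inv_cancel]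
        exact mul_inv_eq_one.1 (htf _ this)
      · exact (hf.le_iff _ _).2 ⟨y, by rw [pow_succ, pow_mul, hy]⟩
    rw [h, h3]
    push_cast
    rw [add_assoc]

end IsTPFiltration

theorem exists_isTPFiltration {p : ℕ} (t : ℝ) {A : Type*} [CommGroup A]
    (hdiv : ∀ x : A, x ≠ 1 → ∃ n, ¬ ∃ y : A, y ^ p ^ n = x) :
    ∃ f : A → EReal, IsTPFiltration p t f := by
  classical
  have h : ∀ x : A, ∃ a : EReal, (x = 1 → a = ⊤) ∧ (x ≠ 1 → ∃ n : ℕ,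
      (∃ y : A, y ^ p ^ n = x) ∧ (¬ ∃ y : A, y ^ p ^ (n + 1) = x) ∧
        a = ((t + n : ℝ) : EReal)) := by
    intro x
    by_cases hx : x = 1
    · exact ⟨⊤, fun _ => rfl, fun h => absurd hx h⟩
    have h0 : Nat.find (hdiv x hx) ≠ 0 := fun h0 =>
      (Nat.find_eq_zero (hdiv x hx)).1 h0 ⟨x, by simp⟩
    obtain ⟨n, hn⟩ := Nat.exists_eq_succ_of_ne_zero h0
    refine ⟨_, fun h => absurd h hx, fun _ => ⟨n, ?_, ?_, rfl⟩⟩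
    · exact not_not.1 (Nat.find_min (hdiv x hx) (hn ▸ n.lt_succ_self))
    · have := Nat.find_spec (hdiv x hx)
      rwa [hn] at this
  choose f hf using h
  exact ⟨f, (hf 1).1 rfl, fun x hx => (hf x).2 hx⟩

/-! ### Finite rank -/

theorem list_prod_ofFn_pow_single {Γ : Type*} [Monoid Γ] {e : ℕ} (g : Fin e → Γ) (i : Fin e)
    (n : ℕ) : (List.ofFn fun j => g j ^ (Pi.single i n : Fin e → ℕ) j).prod = g i ^ n := by
  induction e with
  | zero => exact i.elim0
  | succ e ih =>
    rw [List.ofFn_succ, List.prod_cons]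
    refine Fin.cases ?_ (fun i => ?_) i
    · simp
    · have h : ∀ j : Fin e, (Pi.single i.succ n : Fin (e + 1) → ℕ) j.succ =
          (Pi.single i n : Fin e → ℕ) j := fun j => by
        simp [Pi.single_apply]
      rw [Pi.single_eq_of_ne (Fin.succ_ne_zero i).symm, pow_zero, one_mul]
      simp only [h]
      exact ih (fun j => g j.succ) i

namespace IsPValuation
variable {p : ℕ} {Γ : Type*} [Group Γ] {v : Γ → EReal}

theorem exists_eq_pow_of_roots (hp : 1 < p) (hv : IsPValuation p v) {c : ℝ}
    (hroot : ∀ x, (c : EReal) ≤ v x → ∃ y, y ^ p = x) {x : Γ} (hx : x ≠ 1) :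
    ∃ (y : Γ) (n : ℕ), y ^ p ^ n = x ∧ v y < c := by
  suffices h : ∀ (k : ℕ) (x : Γ), x ≠ 1 → v x < ((c + k : ℝ) : EReal) →
      ∃ (y : Γ) (n : ℕ), y ^ p ^ n = x ∧ v y < c by
    obtain ⟨a, ha⟩ := hv.exists_real hp hx
    obtain ⟨k, hk⟩ := exists_nat_gt (a - c)
    exact h k x hx (by rw [ha]; exact_mod_cast (sub_lt_iff_lt_add'.1 hk))
  intro k
  induction k with
  | zero => exact fun x _ h => ⟨x, 0, by simp, by simpa using h⟩
  | succ k ih =>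
    intro x hx h
    rcases lt_or_ge (v x) c with hc | hc
    · exact ⟨x, 0, by simp, hc⟩
    obtain ⟨z, rfl⟩ := hroot x hc
    have hz : z ≠ 1 := by rintro rfl; exact hx (one_pow p)
    obtain ⟨a, ha⟩ := hv.exists_real hp hz
    rw [hv.map_pow, ha] at h
    have h' : a + 1 < c + (k + 1 : ℕ) := by exact_mod_cast h
    push_cast at h'
    obtain ⟨y, n, hy, hyc⟩ := ih z hz (by
      rw [ha]; exact EReal.coe_lt_coe_iff.2 (by linarith))
    exact ⟨y, n + 1, by rw [pow_succ, pow_mul, hy], hyc⟩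

/-- A `p`-valuation has finite rank as soon as, for some `c`, every element of value at least `c` is
a `p`-th power and `{v ≥ c}` has finite index: coset representatives give the generators. -/
theorem hasFiniteRank (hp : p.Prime) (hv : IsPValuation p v) {c : ℝ}
    (hroot : ∀ x, (c : EReal) ≤ v x → ∃ y, y ^ p = x) [Finite (Γ ⧸ hv.ball c)] :
    HasFiniteRank v := by
  obtain ⟨e, ⟨q⟩⟩ := Finite.exists_equiv_fin (Γ ⧸ hv.ball c)
  refine ⟨e, fun i => (q.symm i).out, fun x hx => ?_⟩
  obtain ⟨y, n, rfl, hyc⟩ := hv.exists_eq_pow_of_roots hp.one_lt hroot hx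
  set i := q (y : Γ ⧸ hv.ball c) with hi
  set r : Γ := (q.symm i).out with hr
  have hry : (c : EReal) ≤ v (r⁻¹ * y) := by
    have : (r : Γ ⧸ hv.ball c) = y := by rw [hr, QuotientGroup.out_eq', hi, q.symm_apply_apply]
    exact QuotientGroup.eq.1 this
  have hle : v y ≤ v r := by
    have := hv.min_le y (r⁻¹ * y)
    rw [min_eq_left (hyc.le.trans hry)] at this
    simpa using this
  have hle' : v r ≤ v y := by
    by_contra! hlt
    have := hv.min_le_mul r (r⁻¹ * y)
    rw [mul_inv_cancel_left] at this
    exact (lt_min hlt (hyc.trans_le hry)).not_ge this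
  have hvr : v r = v y := le_antisymm hle' hle
  refine ⟨Pi.single i (p ^ n), fun j => ?_, ?_⟩
  · rcases eq_or_ne j i with rfl | hj
    · rw [Pi.single_eq_same, hv.map_pow_prime_pow, hv.map_pow_prime_pow, ← hvr]
    · rw [Pi.single_eq_of_ne hj, pow_zero, hv.map_one]
      exact le_top
  · rw [list_prod_ofFn_pow_single (fun i => (q.symm i).out)]
    have := hv.lt_map_pow_prime_pow hp (x := r) (y := y) (by
      rw [hvr]; exact hyc.trans_le hry) n
    rwa [hv.map_pow_prime_pow, hvr, ← hv.map_pow_prime_pow] at this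

end IsPValuation

/-! ### Constructions of `p`-valuations -/

namespace IsPValuation
variable {p : ℕ} {Γ : Type*} [Group Γ] {v : Γ → EReal}

/-- A `p`-valuation is invariant under inner automorphisms, since `⁅h, x⁆` has larger value
than `x`. -/
theorem map_conj (hp : 1 < p) (hv : IsPValuation p v) (h x : Γ) : v (h * x * h⁻¹) = v x := by
  have key : ∀ h x : Γ, v x ≤ v (h * x * h⁻¹) := by
    intro h x
    have h1 : v x ≤ v ⁅h, x⁆ :=
      (le_add_of_nonneg_left (hv.pos hp h).le).trans (hv.add_le_commutator h x)
    have := hv.min_le_mul ⁅h, x⁆ x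
    rw [min_eq_right h1] at this
    simpa [commutatorElement_def] using this
  refine le_antisymm ?_ (key h x)
  simpa [mul_assoc] using key h⁻¹ (h * x * h⁻¹)

theorem comp_mulEquiv {Δ : Type*} [Group Δ] (hv : IsPValuation p v) (φ : Δ ≃* Γ) :
    IsPValuation p (v ∘ φ) where
  min_le x y := by simpa using hv.min_le (φ x) (φ y)
  add_le_commutator x y := by simpa using hv.add_le_commutator (φ x) (φ y)
  eq_top_iff x := by simp [hv.eq_top_iff]
  lt x := hv.lt _
  map_pow x := by simp [hv.map_pow]

/-- A finite infimum is attained, which is what makes it satisfy the strict bound and the axiom on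
`p`-th powers. -/
theorem iInf {ι : Type*} [Finite ι] [Nonempty ι] {w : ι → Γ → EReal}
    (hw : ∀ i, IsPValuation p (w i)) : IsPValuation p (fun x => ⨅ i, w i x) := by
  have hatt : ∀ x, ∃ i, w i x = ⨅ i, w i x := fun x => exists_eq_ciInf_of_finite
  refine ⟨fun x y => ?_, fun x y => ?_, fun x => ?_, fun x => ?_, fun x => ?_⟩
  · exact le_iInf fun i => (min_le_min (iInf_le _ i) (iInf_le _ i)).trans ((hw i).min_le x y)
  · exact le_iInf fun i =>
      (add_le_add (iInf_le _ i) (iInf_le _ i)).trans ((hw i).add_le_commutator x y)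
  · simp [iInf_eq_top, (hw _).eq_top_iff]
  · obtain ⟨i, hi⟩ := hatt x
    rw [← hi]
    exact (hw i).lt x
  · apply le_antisymm
    · obtain ⟨i, hi⟩ := hatt x
      rw [← hi, ← (hw i).map_pow]
      exact iInf_le _ i
    · refine le_iInf fun i => ?_
      rw [(hw i).map_pow]
      exact add_le_add_left (iInf_le _ i) 1

theorem inf_quotient (hv : IsPValuation p v) {L : Subgroup Γ} [L.Normal] {f : Γ ⧸ L → EReal}
    (hf : IsPValuation p f) : IsPValuation p (fun x : Γ => min (v x) (f x)) where
  min_le x y := by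
    rw [min_min_min_comm]
    exact min_le_min (hv.min_le x y) (hf.min_le x y)
  add_le_commutator x y := by
    exact le_min ((add_le_add (min_le_left _ _) (min_le_left _ _)).trans (hv.add_le_commutator x y))
      ((add_le_add (min_le_right _ _) (min_le_right _ _)).trans
        (hf.add_le_commutator (x : Γ ⧸ L) (y : Γ ⧸ L)))
  eq_top_iff x := by
    rw [min_eq_top, hv.eq_top_iff, and_iff_left_iff_imp]
    rintro rfl
    exact hf.map_one
  lt x := lt_min (hv.lt x) (hf.lt _)
  map_pow x := by
    have hmono : Monotone fun a : EReal => a + 1 := fun a b h => add_le_add_left h 1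
    rw [hv.map_pow, QuotientGroup.mk_pow, hf.map_pow]
    exact (hmono.map_min).symm

/-- On a compact group the bound `1 / (p - 1) < v x` is uniform: below any real `c` the value of
`x` depends only on its coset modulo `{v ≥ c}`. -/
theorem exists_lt_forall_lt (hv : IsPValuation p v)
    [Finite (Γ ⧸ hv.ball (1 / ((p : ℝ) - 1) + 1 : ℝ))] :
    ∃ t : ℝ, 1 / ((p : ℝ) - 1) < t ∧ ∀ x, (t : EReal) < v x := by
  set b : ℝ := 1 / ((p : ℝ) - 1)
  obtain ⟨q, hq⟩ := exists_eq_ciInf_of_finite (f := fun q : Γ ⧸ hv.ball (b + 1 : ℝ) => v q.out)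
  have hlt : (b : EReal) < min (v q.out) (b + 1 : ℝ) :=
    lt_min (hv.lt _) (EReal.coe_lt_coe_iff.2 (lt_add_one b))
  obtain ⟨t, hbt, ht⟩ := EReal.lt_iff_exists_real_btwn.1 hlt
  refine ⟨t, EReal.coe_lt_coe_iff.1 hbt, fun x => ?_⟩
  set r : Γ := (x : Γ ⧸ hv.ball (b + 1 : ℝ)).out with hr
  have h1 : ((b + 1 : ℝ) : EReal) ≤ v (r⁻¹ * x) :=
    QuotientGroup.eq.1 (QuotientGroup.out_eq' (x : Γ ⧸ hv.ball (b + 1 : ℝ)))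
  have h2 : v q.out ≤ v r := hq.trans_le (iInf_le _ _)
  have := hv.min_le_mul r (r⁻¹ * x)
  rw [mul_inv_cancel_left] at this
  exact (ht.trans_le (min_le_min h2 h1)).trans_le this

end IsPValuation

/-! ### Topological consequences -/

theorem range_pow_mem_nhds_one {p : ℕ} [Fact p.Prime] {G : Type*} [Group G] [TopologicalSpace G]
    (hG : IsPAdicAnalytic p G) {H : Subgroup G} (hH : IsOpen (H : Set G)) {n : ℕ} (hn : n ≠ 0) :
    Set.range (fun x : H => x ^ n) ∈ 𝓝 1 := by
  obtain ⟨d, _, _⟩ := hG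
  have hmap := map_pow_nhds_one (𝕜 := ℚ_[p]) (E := Fin d → ℚ_[p]) (G := G) (n := n)
    (Nat.cast_ne_zero.2 hn)
  have hcoe : Filter.map ((↑) : H → G) (𝓝 1) = 𝓝 1 := by
    exact hH.isOpenEmbedding_subtypeVal.map_nhds_eq (1 : H)
  have h : Filter.map (fun x : H => x ^ n) (𝓝 1) = 𝓝 1 := by
    apply Filter.map_injective Subtype.val_injective
    rw [hcoe, Filter.map_map]
    conv_rhs => rw [← hmap, ← hcoe, Filter.map_map]
    rfl
  rw [← h]
  exact Filter.range_mem_map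

theorem IsPValuation.isOpen_ball {p : ℕ} {Γ : Type*} [Group Γ] [TopologicalSpace Γ]
    [IsTopologicalGroup Γ] {v : Γ → EReal} (hv : IsPValuation p v) {c : EReal}
    (hc : {x | c ≤ v x} ∈ 𝓝 1) : IsOpen (hv.ball c : Set Γ) :=
  (hv.ball c).isOpen_of_mem_nhds hc

/-- On a compact group in which the `p`-th powers form a neighbourhood of `1`, a `p`-valuation with
open balls that is bounded above by a complete one is itself complete and of finite rank. -/
theorem IsCompletePValued.of_le {p : ℕ} (hp : p.Prime) {Γ : Type*} [Group Γ] [TopologicalSpace Γ]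
    [IsTopologicalGroup Γ] [CompactSpace Γ] (hroot : Set.range (fun x : Γ => x ^ p) ∈ 𝓝 1)
    {v w : Γ → EReal} (hv : IsCompletePValued p v) (hw : IsPValuation p w) (hwv : ∀ x, w x ≤ v x)
    (hnhds : ∀ c : ℝ, {x | (c : EReal) ≤ w x} ∈ 𝓝 1) : IsCompletePValued p w := by
  have hbasis : (𝓝 (1 : Γ)).HasBasis (fun _ : ℝ => True)
      (fun c => {x : Γ | (c : EReal) ≤ w x}) := by
    refine ⟨fun s => ⟨fun hs => ?_, fun ⟨c, _, hc⟩ => Filter.mem_of_superset (hnhds c) hc⟩⟩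
    obtain ⟨c, _, hc⟩ := hv.nhds_one.mem_iff.1 hs
    exact ⟨c, trivial, fun x hx => hc (le_trans hx (hwv x))⟩
  refine ⟨hw, hbasis, fun u hu => ?_, ?_⟩
  · obtain ⟨x, hx⟩ := hv.complete u fun c => by
      obtain ⟨N, hN⟩ := hu c
      exact ⟨N, fun m hm n hn => (hN m hm n hn).trans (hwv _)⟩
    refine ⟨x, fun c => ?_⟩
    obtain ⟨d, _, hd⟩ := hv.nhds_one.mem_iff.1 (hnhds c)
    obtain ⟨N, hN⟩ := hx d
    exact ⟨N, fun n hn => hd (hN n hn)⟩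
  · obtain ⟨c, _, hc⟩ := hbasis.mem_iff.1 hroot
    have := (hw.ball c).quotient_finite_of_isOpen (hw.isOpen_ball (hnhds c))
    exact hw.hasFiniteRank hp (c := c) fun x hx => hc hx

theorem mem_finiteRadical {G : Type*} [Group G] [TopologicalSpace G] [IsTopologicalGroup G]
    [CompactSpace G] {H : Subgroup G} (hH : IsOpen (H : Set G)) {K : Subgroup H} [hK : K.Normal]
    [Finite K] {x : H} (hx : x ∈ K) : (x : G) ∈ finiteRadical G := by
  refine ⟨?_, ?_⟩
  · rw [Submonoid.isOfFinOrder_coe]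
    exact Submonoid.isOfFinOrder_coe.2 (isOfFinOrder_of_finite (⟨x, hx⟩ : K))
  · have := H.quotient_finite_of_isOpen hH
    refine (Set.finite_range fun q : (G ⧸ H) × K =>
      q.1.out * ((q.2 : H) : G) * q.1.out⁻¹).subset ?_
    intro y hy
    obtain ⟨g, rfl⟩ := isConj_iff.1 (show IsConj (x : G) y from hy)
    set s : G := (g : G ⧸ H).out with hs
    have hsg : s⁻¹ * g ∈ H := QuotientGroup.eq.1 (QuotientGroup.out_eq' (g : G ⧸ H))
    refine ⟨(g, ⟨_, hK.conj_mem x hx ⟨s⁻¹ * g, hsg⟩⟩), ?_⟩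
    simp only [← hs, Subgroup.coe_mul, Subgroup.coe_inv]
    group

/-- If `G` has trivial finite radical, its finite-by-(nilpotent `p`-valuable) radical is
`p`-valuable. -/
theorem IsFNp.isPValuable {p : ℕ} {G : Type*} [Group G] [TopologicalSpace G]
    [IsTopologicalGroup G] [CompactSpace G] (hΔ : finiteRadical G = {1}) {H : Subgroup G}
    (hH : IsFNp p H) : IsPValuable p H := by
  obtain ⟨⟨-, hopen, K, hK, hfin, -, v, hv⟩, -⟩ := hH
  have hK1 : ∀ x ∈ K, x = 1 := fun x hx => by
    have : (x : G) ∈ finiteRadical G := mem_finiteRadical hopen hx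
    rw [hΔ] at this
    exact Subtype.ext this
  have hbot : K = ⊥ := (Subgroup.eq_bot_iff_forall K).2 hK1
  let φ : H ≃* H ⧸ K := MulEquiv.ofBijective (QuotientGroup.mk' K)
    ⟨(MonoidHom.ker_eq_bot_iff _).1 (by rw [QuotientGroup.ker_mk', hbot]),
      QuotientGroup.mk'_surjective K⟩
  have hφ : IsOpenEmbedding φ :=
    .of_continuous_injective_isOpenMap QuotientGroup.continuous_mk φ.injective
      QuotientGroup.isOpenMap_coe
  refine ⟨v ∘ φ, hv.isPValuation.comp_mulEquiv φ, ?_, fun u hu => ?_, ?_⟩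
  · rw [hφ.isInducing.nhds_eq_comap, _root_.map_one]
    exact hv.nhds_one.comap φ
  · obtain ⟨x, hx⟩ := hv.complete (φ ∘ u) (by simpa using hu)
    obtain ⟨x, rfl⟩ := φ.surjective x
    exact ⟨x, by simpa using hx⟩
  · obtain ⟨e, g, hg⟩ := hv.finiteRank
    refine ⟨e, φ.symm ∘ g, fun x hx => ?_⟩
    obtain ⟨m, h1, h2⟩ := hg (φ x) (by simpa using hx)
    refine ⟨m, by simpa using h1, ?_⟩
    simpa [_root_.map_list_prod, List.map_ofFn, Function.comp_def] using h2

/-! ### The invariant valuation and its quotient -/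

theorem continuous_conjNormal {G : Type*} [Group G] [TopologicalSpace G] [IsTopologicalGroup G]
    {H : Subgroup G} [H.Normal] (g : G) : Continuous (MulAut.conjNormal g : MulAut H) := by
  refine continuous_induced_rng.2 ?_
  have : (Subtype.val ∘ (MulAut.conjNormal g : MulAut H)) = fun x : H => g * x * g⁻¹ := by
    funext x; simp
  rw [this]
  fun_prop

/-- The minimum of the finitely many `G`-conjugates of a `p`-valuation on an open normal subgroup. -/
theorem exists_invariant_isPValuation {p : ℕ} (hp : 1 < p) {G : Type*} [Group G]
    [TopologicalSpace G] [IsTopologicalGroup G] [CompactSpace G] {H : Subgroup G} [H.Normal]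
    (hH : IsOpen (H : Set G)) {v : H → EReal} (hv : IsPValuation p v)
    (hnhds : ∀ c : ℝ, {x | (c : EReal) ≤ v x} ∈ 𝓝 1) :
    ∃ w : H → EReal, IsPValuation p w ∧ (∀ x, w x ≤ v x) ∧
      (∀ c : ℝ, {x | (c : EReal) ≤ w x} ∈ 𝓝 1) ∧
      ∀ (g : G) (x : H), w (MulAut.conjNormal g x) = w x := by
  have := H.quotient_finite_of_isOpen hH
  set w : H → EReal := fun x => ⨅ q : G ⧸ H, v (MulAut.conjNormal q.out x) with hw
  have hwle : ∀ (g : G) (x : H), w x ≤ v (MulAut.conjNormal g x) := by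
    intro g x
    set s : G := (g : G ⧸ H).out with hs
    have hsg : s⁻¹ * g ∈ H := QuotientGroup.eq.1 (QuotientGroup.out_eq' (g : G ⧸ H))
    have hgs : g * s⁻¹ ∈ H := by
      simpa [mul_assoc] using ‹H.Normal›.conj_mem _ hsg s
    have e : (MulAut.conjNormal g x : H) =
        ⟨g * s⁻¹, hgs⟩ * MulAut.conjNormal s x * (⟨g * s⁻¹, hgs⟩ : H)⁻¹ := by
      ext
      simp [mul_assoc]
    rw [e, hv.map_conj hp]
    exact iInf_le _ (g : G ⧸ H)
  refine ⟨w, .iInf fun q => hv.comp_mulEquiv (MulAut.conjNormal q.out),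
    fun x => by simpa using hwle 1 x, fun c => ?_, ?_⟩
  · simp only [hw, le_iInf_iff, Set.ofPred_forall]
    refine Filter.iInter_mem.2 fun q => ?_
    have := (continuous_conjNormal (H := H) (q.out)).continuousAt (x := 1)
    exact this (by rw [_root_.map_one]; exact hnhds c)
  · have key : ∀ (g : G) (x : H), w x ≤ w (MulAut.conjNormal g x) := by
      intro g x
      refine le_iInf fun q => ?_
      rw [← MulAut.mul_apply, ← _root_.map_mul]
      exact hwle _ x
    intro g x
    refine le_antisymm ?_ (key g x)
    simpa [← MulAut.mul_apply, ← _root_.map_mul] using key g⁻¹ (MulAut.conjNormal g x)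

/-- In the quotient by a closed subgroup, no nontrivial element is infinitely `p`-divisible, because
`p ^ n`-th powers tend to `1`. -/
theorem exists_not_pow_of_ne_one {p : ℕ} (hp : 1 < p) {Γ : Type*} [Group Γ] [TopologicalSpace Γ]
    [IsTopologicalGroup Γ] {v : Γ → EReal} (hv : IsPValuation p v)
    (hbasis : (𝓝 (1 : Γ)).HasBasis (fun _ : ℝ => True) (fun c => {x : Γ | (c : EReal) ≤ v x}))
    {L : Subgroup Γ} [L.Normal] (hL : IsClosed (L : Set Γ)) {a : Γ ⧸ L} (ha : a ≠ 1) :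
    ∃ n, ¬ ∃ b : Γ ⧸ L, b ^ p ^ n = a := by
  obtain ⟨x, rfl⟩ := QuotientGroup.mk_surjective a
  have hx : x ∉ L := fun h => ha ((QuotientGroup.eq_one_iff x).2 h)
  have hU : {u : Γ | x * u ∉ L} ∈ 𝓝 1 :=
    (hL.isOpen_compl.preimage (continuous_const_mul x)).mem_nhds (by simpa using hx)
  obtain ⟨c, -, hc⟩ := hbasis.mem_iff.1 hU
  obtain ⟨n, hn⟩ := exists_nat_ge c
  refine ⟨n, ?_⟩
  rintro ⟨b, hb⟩
  obtain ⟨y, rfl⟩ := QuotientGroup.mk_surjective b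
  refine hc (show (c : EReal) ≤ v (y ^ p ^ n)⁻¹ from ?_) ?_
  · rw [hv.map_inv, hv.map_pow_prime_pow]
    have h1 : (c : EReal) ≤ (n : EReal) := by exact_mod_cast hn
    exact h1.trans (le_add_of_nonneg_left (hv.pos hp y).le)
  · rw [← QuotientGroup.eq_one_iff, QuotientGroup.mk_mul, QuotientGroup.mk_inv,
      QuotientGroup.mk_pow, hb, mul_inv_cancel]

/-- If `v` exceeds `t` everywhere, then replacing `v` by its minimum with the `(t, p)`-filtration of
the quotient makes the quotient valuation equal to that filtration. -/
theorem quotientVal_min {p : ℕ} {t : ℝ} {Γ : Type*} [Group Γ] {v : Γ → EReal}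
    (hv : IsPValuation p v) (ht : ∀ x, (t : EReal) < v x) {L : Subgroup Γ} [L.Normal]
    {f : Γ ⧸ L → EReal} (hf : IsTPFiltration p t f) :
    quotientVal L (fun x => min (v x) (f x)) = f := by
  funext a
  obtain ⟨x, rfl⟩ := QuotientGroup.mk_surjective a
  refine le_antisymm (iSup_le fun g => (min_le_right _ _).trans (congrArg f g.2).le) ?_
  -- A coset of filtration value `t + n` contains a `p ^ n`-th power, which has value above `t + n`.
  have key : ∃ z : Γ, (z : Γ ⧸ L) = x ∧ f x ≤ v z := by
    by_cases hx : (x : Γ ⧸ L) = 1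
    · exact ⟨1, hx.symm, by simp [hv.map_one]⟩
    · obtain ⟨n, ⟨b, hb⟩, -, h⟩ := hf.2 x hx
      obtain ⟨y, rfl⟩ := QuotientGroup.mk_surjective b
      refine ⟨y ^ p ^ n, hb, ?_⟩
      rw [h, hv.map_pow_prime_pow, EReal.coe_add]
      exact add_le_add (ht y).le (by simp)
  obtain ⟨z, hz, hle⟩ := key
  refine le_trans ?_ (le_iSup (fun g : {g : Γ // (g : Γ ⧸ L) = x} => min (v g) (f g)) ⟨z, hz⟩)
  rw [hz]
  exact le_min hle le_rfl

end PVal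

theorem theoremB (p : ℕ) [Fact p.Prime] {G : Type*} [Group G] [TopologicalSpace G]
    [IsTopologicalGroup G] [CompactSpace G] [T2Space G]
    (hG : PVal.IsPAdicAnalytic p G) (hGnil : Group.IsVirtuallyNilpotent G)
    (hΔ : PVal.finiteRadical G = {1})
    (H : Subgroup G) [H.Normal] (hH : PVal.IsFNp p H)
    (L : Subgroup H) [L.Normal] (hLproper : L ≠ ⊤) (hLclosed : IsClosed (L : Set H))
    (hLisolated : PVal.IsIsolated L) (hLchar : PVal.IsCharacteristic L)
    (hLcomm : commutator H ≤ L) :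
    ∃ v : H → EReal, PVal.IsCompletePValued p v ∧
      (∀ (g : G) (x : H), v (MulAut.conjNormal g x) = v x) ∧
      ∃ t : ℝ, 1 / ((p : ℝ) - 1) < t ∧ (∀ l ∈ L, (t : EReal) < v l) ∧
        PVal.IsPValuation p (PVal.quotientVal L v) ∧
        PVal.IsTPFiltration p t (PVal.quotientVal L v) := by
  have hp : p.Prime := Fact.out
  have hopen : IsOpen (H : Set G) := hH.1.2.1
  have : CompactSpace H := isCompact_iff_compactSpace.1 (H.isClosed_of_isOpen hopen).isCompact
  obtain ⟨v₀, hv₀⟩ := hH.isPValuable hΔ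
  obtain ⟨w, hw, hwle, hwnhds, hwG⟩ := PVal.exists_invariant_isPValuation hp.one_lt hopen
    hv₀.isPValuation fun c => hv₀.nhds_one.mem_of_mem (i := c) trivial
  have := (hw.ball (1 / ((p : ℝ) - 1) + 1 : ℝ)).quotient_finite_of_isOpen
    (hw.isOpen_ball (hwnhds _))
  obtain ⟨t, ht, htw⟩ := hw.exists_lt_forall_lt
  have hmul : ∀ a b : H ⧸ L, a * b = b * a := by
    intro a b
    obtain ⟨x, rfl⟩ := QuotientGroup.mk_surjective a
    obtain ⟨y, rfl⟩ := QuotientGroup.mk_surjective b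
    rw [← commutatorElement_eq_one_iff_mul_comm]
    exact (QuotientGroup.eq_one_iff _).2
      (hLcomm (Subgroup.commutator_mem_commutator (Subgroup.mem_top x) (Subgroup.mem_top y)))
  let _ : CommGroup (H ⧸ L) := { (inferInstance : Group (H ⧸ L)) with mul_comm := hmul }
  have htf : ∀ a : H ⧸ L, a ^ p = 1 → a = 1 := by
    intro a ha
    obtain ⟨x, rfl⟩ := QuotientGroup.mk_surjective a
    rw [← QuotientGroup.mk_pow, QuotientGroup.eq_one_iff] at ha
    exact (QuotientGroup.eq_one_iff x).2 (hLisolated x p hp.ne_zero ha)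
  obtain ⟨f, hf⟩ := PVal.exists_isTPFiltration (p := p) t (A := H ⧸ L) fun a ha =>
    PVal.exists_not_pow_of_ne_one hp.one_lt hv₀.isPValuation hv₀.nhds_one hLclosed ha
  have hfv : PVal.IsPValuation p f := hf.isPValuation ht htf
  have hq : PVal.quotientVal L (fun x => min (w x) (f x)) = f := PVal.quotientVal_min hw htw hf
  refine ⟨fun x => min (w x) (f x), ?_, fun g x => ?_, t, ht, fun l hl => ?_, ?_, ?_⟩
  · refine hv₀.of_le hp (PVal.range_pow_mem_nhds_one hG hopen hp.ne_zero)
      (hw.inf_quotient hfv) (fun x => (min_le_left _ _).trans (hwle x)) fun c => ?_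
    obtain ⟨n, hn⟩ := exists_nat_ge (c - t)
    filter_upwards [hwnhds c,
      PVal.range_pow_mem_nhds_one hG hopen (pow_ne_zero n hp.ne_zero)] with x hx hxn
    obtain ⟨y, rfl⟩ := hxn
    refine le_min hx (le_trans ?_ ((hf.le_iff _ n).2 ⟨y, rfl⟩))
    exact EReal.coe_le_coe_iff.2 (by linarith)
  · have hmem : ∀ (g : G), ∀ x ∈ L, MulAut.conjNormal g x ∈ L := fun g x hx =>
      hLchar
        { (MulAut.conjNormal g : MulAut H) with
          continuous_toFun := PVal.continuous_conjNormal g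
          continuous_invFun := by
            have := PVal.continuous_conjNormal (H := H) g⁻¹
            rwa [map_inv] at this } x hx
    have hmap : L.map (MulAut.conjNormal g : MulAut H).toMonoidHom = L := by
      refine le_antisymm (Subgroup.map_le_iff_le_comap.2 fun x hx => hmem g x hx) fun x hx =>
        ⟨MulAut.conjNormal g⁻¹ x, hmem g⁻¹ x hx, ?_⟩
      simp
    have : f (MulAut.conjNormal g x : H) = f x :=
      hf.comp_mulEquiv (QuotientGroup.congr L L (MulAut.conjNormal g) hmap) x
    simp only [hwG, this]
  · have : (l : H ⧸ L) = 1 := (QuotientGroup.eq_one_iff l).2 hl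
    simp [this, hf.1, htw l]
  · rw [hq]; exact hfv
  · rw [hq]; exact hf
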